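/- Let $C,\xi\in\mathbb{R}$ and $k\in(0,1)$, put $k'=\sqrt{1-k^2}$, $\omega=\sqrt{3|C-1|}$, and assume $C\neq 1$. Consider the equation $$W''=r(z)\,W,\qquad r=-q+\tfrac12 p'+\tfrac14 p^2,\qquad (*)$$ on the Riemann sphere, where $$p(z)=\frac{z\,(-1+2(k^2-z^2))}{(k^2-z^2)(z^2+k'^2)},\qquad q(z)=\begin{cases}\dfrac{-\xi+(1+\omega z)^2+\omega^2(z^2+k'^2)}{\omega^2(k^2-z^2)(z^2+k'^2)}, & C<1,\\[3mm] \dfrac{-\xi+(1+\omega z)^2-\omega^2(k^2-z^2)}{\omega^2(k^2-z^2)(z^2+k'^2)}, & C>1.\end{cases}$$ Suppose that $2\xi\neq 3(1-C)$. Then, with $\zeta=1/z$: 1. The exponents of $(*)$ at $z=\infty$ (i.e. the roots of the indicial equation at $\zeta=0$ of the equation obtained from $(*)$ by $z=1/\zeta$) are exactly $-2$ and $1$. 2. There are functions $f$, $V$ holomorphic near $\zeta=0$, with $f(0)=1$, such that for $|z|$ large and every local branch of $\ln\zeta$ $$W_1=\zeta f(\zeta),\qquad W_2=g_3\,W_1\ln\zeta+\zeta^{-2}V(\zeta)$$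 is a fundamental system of solutions of $(*)$, where $g_3$ is the coefficient of $\zeta^3$ in the Taylor series of $1/f(\zeta)^2$ at $0$. It is $$g_3=\frac{\omega^2-2\xi}{9\omega^3}\ \text{ if } C<1,\qquad g_3=\frac{-\omega^2-2\xi}{9\omega^3}\ \text{ if } C>1,$$ and $g_3\neq 0$, so the logarithmic term is present. 3. The local monodromy of $(*)$ at $z=\infty$ is $\begin{bmatrix}1&2\pi i\\0&1\end{bmatrix}$. That is, there is an $R>0$ such that $r$ is holomorphic in $|z|>R$ and for every base point $z_0$ with $|z_0|>R$ there is a fundamental system of solutions $(W_1,W_2)$ of $(*)$ near $z_0$ (not necessarily the one in part 2) whose analytic continuation along every loop in $\{|z|>R\}$ based at $z_0$ that goes once around infinity (counterclockwise in the coordinate $\zeta$, i.e. $1/z$ has winding number $1$ around $0$) is $$(W_1,W_2)\begin{bmatrix}1&2\pi i\\0&1\end{bmatrix}.$$ -/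

import Mathlib

open Filter Topology

noncomputable section

namespace LinODE

/-! ### Second order linear equations `w'' + p w' + q w = 0` in the complex domain -/

/-- `w` is a holomorphic solution of `w'' + p w' + q w = 0` in a neighbourhood of `z₀`. -/
def IsSolutionNear (p q : ℂ → ℂ) (w : ℂ → ℂ) (z₀ : ℂ) : Prop :=
  AnalyticAt ℂ w z₀ ∧
    ∀ᶠ z in 𝓝 z₀, deriv (deriv w) z + p z * deriv w z + q z * w z = 0

/-- The matrix of a pair of functions and their derivatives,
`[[W₀, W₁], [W₀', W₁']]`, at the point `z`. -/
def fundamentalMatrix (W : Fin 2 → ℂ → ℂ) (z : ℂ) : Matrix (Fin 2) (Fin 2) ℂ :=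
  !![W 0 z, W 1 z; deriv (W 0) z, deriv (W 1) z]

/-- `W₀, W₁` is a fundamental system of solutions of `w'' + p w' + q w = 0` near `z₀`. -/
def IsFundamentalSystem (p q : ℂ → ℂ) (W : Fin 2 → ℂ → ℂ) (z₀ : ℂ) : Prop :=
  (∀ j, IsSolutionNear p q (W j) z₀) ∧ (fundamentalMatrix W z₀).det ≠ 0

/-- The family `F t` of function germs at `γ t` is an analytic continuation along `γ`:
every `F t` is analytic at `γ t`, and for `s` close to `t` the functions
`F s` and `F t` coincide near `γ s`. -/
def IsContinuationAlong {z₀ z₁ : ℂ} (γ : Path z₀ z₁) (F : unitInterval → ℂ → ℂ) : Prop :=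
  ∀ t, AnalyticAt ℂ (F t) (γ t) ∧ ∀ᶠ s in 𝓝 t, F s =ᶠ[𝓝 (γ s)] F t

/-- Analytic continuation along the closed path `γ` based at `z₀` takes the row of functions
`W = (W₀, W₁)` to the row `W * M`; that is, `M` is the monodromy matrix of `W` along `γ`. -/
def HasMonodromyAlong {z₀ : ℂ} (W : Fin 2 → ℂ → ℂ) (γ : Path z₀ z₀)
    (M : Matrix (Fin 2) (Fin 2) ℂ) : Prop :=
  ∃ F : unitInterval → Fin 2 → ℂ → ℂ,
    (∀ j, IsContinuationAlong γ (fun t => F t j)) ∧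
    (∀ j, F 0 j =ᶠ[𝓝 z₀] W j) ∧
    (∀ j, F 1 j =ᶠ[𝓝 z₀] fun z => ∑ i, W i z * M i j)

/-- The closed path `γ` in the `z`-plane goes once around `z = ∞`, counterclockwise in the
coordinate `ζ = 1 / z`: the path `1 / γ` avoids `0` and has winding number `1` around `0`,
i.e. a continuous logarithm of `1 / γ` increases by `2 π i`. -/
def EncirclesInftyOnce {z₀ : ℂ} (γ : Path z₀ z₀) : Prop :=
  ∃ L : C(unitInterval, ℂ),
    (∀ t, Complex.exp (L t) = (γ t)⁻¹) ∧ L 1 = L 0 + 2 * Real.pi * Complex.I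

/-- `M` is the local monodromy of `w'' + p w' + q w = 0` at `z = ∞`: in some punctured
neighbourhood `R < |z|` of infinity the coefficients are holomorphic, and for every base
point `z₀` in it there is a fundamental system of solutions near `z₀` whose monodromy matrix
is `M` along every loop in this neighbourhood going once around infinity (counterclockwise
in `ζ = 1 / z`). -/
def HasLocalMonodromyAtInfty (p q : ℂ → ℂ) (M : Matrix (Fin 2) (Fin 2) ℂ) : Prop :=
  ∃ R : ℝ, 0 < R ∧
    (∀ z : ℂ, R < ‖z‖ → AnalyticAt ℂ p z ∧ AnalyticAt ℂ q z) ∧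
    ∀ z₀ : ℂ, R < ‖z₀‖ →
      ∃ W : Fin 2 → ℂ → ℂ, IsFundamentalSystem p q W z₀ ∧
        ∀ γ : Path z₀ z₀, (∀ t, R < ‖γ t‖) → EncirclesInftyOnce γ →
          HasMonodromyAlong W γ M

/-- `ρ` is an exponent at the regular singular point `ζ = 0` of `u'' + P u' + Q u = 0`:
`ζ P(ζ)` and `ζ² Q(ζ)` extend holomorphically to `ζ = 0`, and `ρ` is a root of the indicial
equation. -/
def IsExponentAtZero (P Q : ℂ → ℂ) (ρ : ℂ) : Prop :=
  ∃ A B : ℂ → ℂ, AnalyticAt ℂ A 0 ∧ AnalyticAt ℂ B 0 ∧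
    (∀ᶠ ζ in 𝓝[≠] (0 : ℂ), ζ * P ζ = A ζ ∧ ζ ^ 2 * Q ζ = B ζ) ∧
    ρ * (ρ - 1) + A 0 * ρ + B 0 = 0

/-- `ρ` is an exponent of `w'' + p w' + q w = 0` at `z = ∞`, i.e. an exponent at `ζ = 0` of
the equation `u'' + (2/ζ - p(1/ζ)/ζ²) u' + (q(1/ζ)/ζ⁴) u = 0` obtained by putting
`z = 1 / ζ`, `u(ζ) = w(1/ζ)`. -/
def IsExponentAtInfty (p q : ℂ → ℂ) (ρ : ℂ) : Prop :=
  IsExponentAtZero (fun ζ => 2 / ζ - p (1 / ζ) / ζ ^ 2) (fun ζ => q (1 / ζ) / ζ ^ 4) ρ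

/-- The `n`-th Taylor coefficient of `g` at `0`. -/
def taylorCoeff (g : ℂ → ℂ) (n : ℕ) : ℂ := iteratedDeriv n g 0 / (n.factorial : ℂ)

end LinODE

namespace Satellite

/-! ### The normal variational equation in its algebraic form -/

/-- `ω = √(3 |C - 1|)`. -/
def omega (C : ℝ) : ℝ := Real.sqrt (3 * |C - 1|)

/-- The complementary modulus `k' = √(1 - k²)`. -/
def kPrime (k : ℝ) : ℝ := Real.sqrt (1 - k ^ 2)

/-- The coefficient `p(z)` of the equation `Q'' + p Q' + q Q = 0`. -/
def p (k : ℝ) (z : ℂ) : ℂ :=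
  z * (-1 + 2 * ((k : ℂ) ^ 2 - z ^ 2)) /
    (((k : ℂ) ^ 2 - z ^ 2) * (z ^ 2 + (kPrime k : ℂ) ^ 2))

/-- The coefficient `q(z)` of the equation `Q'' + p Q' + q Q = 0`; the first formula is the
one for `C < 1`, the second the one for `C > 1`. -/
def q (C ξ k : ℝ) (z : ℂ) : ℂ :=
  if C < 1 then
    (-(ξ : ℂ) + (1 + (omega C : ℂ) * z) ^ 2
        + (omega C : ℂ) ^ 2 * (z ^ 2 + (kPrime k : ℂ) ^ 2)) /
      ((omega C : ℂ) ^ 2 * ((k : ℂ) ^ 2 - z ^ 2) * (z ^ 2 + (kPrime k : ℂ) ^ 2))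
  else
    (-(ξ : ℂ) + (1 + (omega C : ℂ) * z) ^ 2
        - (omega C : ℂ) ^ 2 * ((k : ℂ) ^ 2 - z ^ 2)) /
      ((omega C : ℂ) ^ 2 * ((k : ℂ) ^ 2 - z ^ 2) * (z ^ 2 + (kPrime k : ℂ) ^ 2))

/-- The coefficient `r = -q + p'/2 + p²/4` of the reduced equation `W'' = r W`. -/
def r (C ξ k : ℝ) (z : ℂ) : ℂ :=
  -q C ξ k z + (1 / 2) * deriv (p k) z + (1 / 4) * (p k z) ^ 2

end Satellite

end

/-!
In the coordinate `ζ = 1 / z` the coefficient is `r = ζ² (2 + ζ σ(ζ))` with `σ` holomorphic at `0`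
(`Satellite.exists_r_inv_eq`), so the indicial polynomial is `(ρ + 2) (ρ - 1)`. Putting `W = ζ f`
turns the equation into `ζ f'' + 4 f' = σ f`, whose recursion for the Taylor coefficients never
degenerates; the coefficients grow at most geometrically, which gives the solution with exponent `1`
(`LinODE.exists_frobenius_solution`).

A second solution is obtained by reduction of order as `W₂ = W₁ P` with `P' = -1 / W₁²`, the
derivative being taken in `z`. In `ζ` this reads `dP / dζ = ζ⁻⁴ / f²`, so that
`P = g₃ ln ζ + ζ⁻³ H(ζ)`, where `g₃` is the coefficient of `ζ³` in `1 / f²` and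
`ζ H' - 3 H = 1 / f² - g₃ ζ³` (`LinODE.exists_analyticAt_id_mul_deriv_sub`). The Wronskian is `-1`.
With `σ = a + b ζ + c ζ² + ⋯` the equation for `f` yields `g₃ = -c / 9 + a b / 9 - a³ / 36`
(`LinODE.taylorCoeff_three_one_div_sq`), and the first three coefficients of `r` turn this into the
stated value, which vanishes only if `2 ξ = 3 (1 - C)`.

A loop around infinity adds `2 π i` to `ln ζ` and leaves `f` and `H` unchanged. As `g₃ ≠ 0`, the
pair `(g₃ W₁, W₂)` is a fundamental system, and it is multiplied by `[[1, 2 π i], [0, 1]]`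
(`LinODE.hasMonodromyAlong_logInvBranch`).
-/

namespace LinODE

/-! ### Taylor coefficients at the origin -/

theorem taylorCoeff_congr {f g : ℂ → ℂ} (h : f =ᶠ[𝓝 0] g) (n : ℕ) :
    taylorCoeff f n = taylorCoeff g n := by
  rw [taylorCoeff, taylorCoeff, h.iteratedDeriv_eq]

theorem taylorCoeff_zero (f : ℂ → ℂ) : taylorCoeff f 0 = f 0 := by
  simp [taylorCoeff]

theorem taylorCoeff_mul {f g : ℂ → ℂ} (hf : AnalyticAt ℂ f 0) (hg : AnalyticAt ℂ g 0) (n : ℕ) :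
    taylorCoeff (fun z => f z * g z) n =
      ∑ i ∈ Finset.range (n + 1), taylorCoeff f i * taylorCoeff g (n - i) := by
  rw [taylorCoeff, iteratedDeriv_fun_mul hf.contDiffAt hg.contDiffAt, Finset.sum_div]
  refine Finset.sum_congr rfl fun i hi => ?_
  have hin : i ≤ n := Nat.lt_succ_iff.mp (Finset.mem_range.mp hi)
  have hn := Nat.choose_mul_factorial_mul_factorial hin
  have h1 : (i.factorial : ℂ) ≠ 0 := by exact_mod_cast i.factorial_ne_zero
  have h2 : ((n - i).factorial : ℂ) ≠ 0 := by exact_mod_cast (n - i).factorial_ne_zero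
  have h3 : (n.factorial : ℂ) ≠ 0 := by exact_mod_cast n.factorial_ne_zero
  have hn' : (n.choose i : ℂ) * i.factorial * (n - i).factorial = n.factorial := by
    exact_mod_cast hn
  rw [taylorCoeff, taylorCoeff]
  field_simp
  rw [← hn']
  ring

theorem taylorCoeff_deriv (f : ℂ → ℂ) (n : ℕ) :
    taylorCoeff (deriv f) n = (n + 1) * taylorCoeff f (n + 1) := by
  have h1 : (n.factorial : ℂ) ≠ 0 := by exact_mod_cast n.factorial_ne_zero
  have h2 : (n + 1 : ℂ) ≠ 0 := by exact_mod_cast n.succ_ne_zero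
  rw [taylorCoeff, taylorCoeff, iteratedDeriv_succ', Nat.factorial_succ]
  push_cast
  field_simp

theorem taylorCoeff_add {f g : ℂ → ℂ} (hf : AnalyticAt ℂ f 0) (hg : AnalyticAt ℂ g 0) (n : ℕ) :
    taylorCoeff (fun z => f z + g z) n = taylorCoeff f n + taylorCoeff g n := by
  rw [taylorCoeff, iteratedDeriv_fun_add hf.contDiffAt hg.contDiffAt, add_div]; rfl

theorem taylorCoeff_const_mul (c : ℂ) {f : ℂ → ℂ} (n : ℕ) :
    taylorCoeff (fun z => c * f z) n = c * taylorCoeff f n := by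
  rw [taylorCoeff, taylorCoeff, iteratedDeriv_const_mul_field, mul_div_assoc]

theorem taylorCoeff_const (c : ℂ) (n : ℕ) :
    taylorCoeff (fun _ => c) n = if n = 0 then c else 0 := by
  rw [taylorCoeff, iteratedDeriv_const]
  split_ifs with h <;> simp [h]

theorem taylorCoeff_id_mul {g : ℂ → ℂ} (hg : AnalyticAt ℂ g 0) (n : ℕ) :
    taylorCoeff (fun z => z * g z) (n + 1) = taylorCoeff g n := by
  rw [taylorCoeff_mul (f := fun z => z) analyticAt_id hg, Finset.sum_eq_single_of_mem 1 (by simp)]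
  · simp [taylorCoeff, iteratedDeriv_fun_id_zero]
  · intro i _ hi
    simp [taylorCoeff, iteratedDeriv_fun_id_zero, hi]

theorem taylorCoeff_id_mul_zero (g : ℂ → ℂ) : taylorCoeff (fun z => z * g z) 0 = 0 := by
  simp [taylorCoeff]

/-- An analytic function is determined near `0` by its Taylor coefficients. -/
theorem eventuallyEq_of_taylorCoeff_eq {f g : ℂ → ℂ} (hf : AnalyticAt ℂ f 0)
    (hg : AnalyticAt ℂ g 0) (h : ∀ n, taylorCoeff f n = taylorCoeff g n) : f =ᶠ[𝓝 0] g := by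
  have hf' := hf.hasFPowerSeriesAt
  have hg' := hg.hasFPowerSeriesAt
  have : (fun n => iteratedDeriv n f 0 / (n.factorial : ℂ)) =
      fun n => iteratedDeriv n g 0 / (n.factorial : ℂ) := funext h
  rw [this] at hf'
  obtain ⟨r₁, hr₁⟩ := hf'
  obtain ⟨r₂, hr₂⟩ := hg'
  filter_upwards [Metric.eball_mem_nhds (0 : ℂ) hr₁.r_pos, Metric.eball_mem_nhds (0 : ℂ) hr₂.r_pos]
    with z h₁ h₂
  have e₁ := hr₁.hasSum_sub h₁
  exact e₁.unique (hr₂.hasSum_sub h₂)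

theorem exists_norm_taylorCoeff_le {f : ℂ → ℂ} (hf : AnalyticAt ℂ f 0) :
    ∃ M s : ℝ, 0 < M ∧ 0 < s ∧ ∀ n, ‖taylorCoeff f n‖ ≤ M * s ^ n := by
  obtain ⟨M, s, hM, hs, h⟩ :=
    FormalMultilinearSeries.le_mul_pow_of_radius_pos _ hf.hasFPowerSeriesAt.radius_pos
  refine ⟨M, s, hM, hs, fun n => ?_⟩
  simpa [FormalMultilinearSeries.ofScalars_norm, taylorCoeff] using h n

/-- A sequence of at most geometric growth is the sequence of Taylor coefficients of an analytic
function. -/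
theorem exists_analyticAt_taylorCoeff_eq {a : ℕ → ℂ} {K : ℝ} (hK : 0 < K)
    (h : ∀ n, ‖a n‖ ≤ K ^ n) :
    ∃ f : ℂ → ℂ, AnalyticAt ℂ f 0 ∧ ∀ n, taylorCoeff f n = a n := by
  set q := FormalMultilinearSeries.ofScalars ℂ a with hq
  have hr : (0 : ENNReal) < q.radius := by
    refine lt_of_lt_of_le ?_ (q.le_radius_of_bound 1 (r := ⟨K⁻¹, by positivity⟩) fun n => ?_)
    · exact ENNReal.coe_pos.mpr (inv_pos.mpr hK)
    · rw [hq, FormalMultilinearSeries.ofScalars_norm]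
      calc ‖a n‖ * K⁻¹ ^ n ≤ K ^ n * K⁻¹ ^ n := by gcongr; exact h n
        _ = 1 := by rw [← mul_pow, mul_inv_cancel₀ hK.ne', one_pow]
  have hf := (q.hasFPowerSeriesOnBall hr).hasFPowerSeriesAt
  refine ⟨q.sum, hf.analyticAt, fun n => ?_⟩
  have := congrArg (fun s => FormalMultilinearSeries.coeff s n)
    (hf.analyticAt.hasFPowerSeriesAt.eq_formalMultilinearSeries hf)
  simpa [hq, taylorCoeff] using this

/-! ### The holomorphic solution at a regular singular point -/

/-- The Taylor coefficients of the solution of `ζ f'' + 4 f' = σ f` with `f 0 = 1`, in terms of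
the Taylor coefficients `s` of `σ`. -/
noncomputable def frobeniusCoeff (s : ℕ → ℂ) : ℕ → ℂ
  | 0 => 1
  | n + 1 => (∑ j : Fin (n + 1), s j * frobeniusCoeff s (n - j)) / ((n + 1) * (n + 4))

theorem frobeniusCoeff_succ (s : ℕ → ℂ) (n : ℕ) :
    (n + 1) * (n + 4) * frobeniusCoeff s (n + 1) =
      ∑ j ∈ Finset.range (n + 1), s j * frobeniusCoeff s (n - j) := by
  have h1 : (n + 1 : ℂ) ≠ 0 := by exact_mod_cast n.succ_ne_zero
  have h2 : (n + 4 : ℂ) ≠ 0 := by exact_mod_cast (n + 3).succ_ne_zero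
  rw [frobeniusCoeff, mul_div_cancel₀ _ (mul_ne_zero h1 h2),
    Finset.sum_range fun j => s j * frobeniusCoeff s (n - j)]

/-- The sum in the recursion has `n + 1` terms, each at most `K ^ (n + 1)`, and is divided by
`(n + 1) (n + 4)`. -/
theorem norm_frobeniusCoeff_le {s : ℕ → ℂ} {M t K : ℝ} (hM : 0 < M) (ht : 0 < t)
    (hs : ∀ n, ‖s n‖ ≤ M * t ^ n) (hMK : M ≤ K) (htK : t ≤ K) (n : ℕ) :
    ‖frobeniusCoeff s n‖ ≤ K ^ n := by
  induction n using Nat.strong_induction_on with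
  | _ n ih =>
    cases n with
    | zero => simp [frobeniusCoeff]
    | succ n =>
      have hK : 0 < K := hM.trans_le hMK
      have h1 : ‖((n : ℂ) + 1) * (n + 4)‖ = ((n : ℝ) + 1) * (n + 4) := by
        rw [norm_mul]
        congr 1
        · exact_mod_cast Complex.norm_natCast (n + 1)
        · exact_mod_cast Complex.norm_natCast (n + 4)
      have h2 : ((n : ℝ) + 1) * (n + 4) * ‖frobeniusCoeff s (n + 1)‖ ≤ (n + 1) * K ^ (n + 1) := by
        rw [← h1, ← norm_mul, frobeniusCoeff_succ]
        calc _ ≤ ∑ j ∈ Finset.range (n + 1), ‖s j * frobeniusCoeff s (n - j)‖ := norm_sum_le _ _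
          _ ≤ ∑ j ∈ Finset.range (n + 1), K ^ (n + 1) := by
            refine Finset.sum_le_sum fun j hj => ?_
            have hjn : j ≤ n := Nat.lt_succ_iff.mp (Finset.mem_range.mp hj)
            rw [norm_mul]
            calc _ ≤ (K * K ^ j) * K ^ (n - j) := by
                  gcongr
                  · exact (hs j).trans (by gcongr)
                  · exact ih _ (by omega)
              _ = K ^ (n + 1) := by
                  rw [mul_assoc, ← pow_add, Nat.add_sub_cancel' hjn, pow_succ']
          _ = _ := by simp
      have h3 : (n + 1 : ℝ) * K ^ (n + 1) ≤ (n + 1) * (n + 4) * K ^ (n + 1) := by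
        have : 0 < K ^ (n + 1) := by positivity
        have hn : (0 : ℝ) ≤ n := n.cast_nonneg
        nlinarith [mul_nonneg (mul_nonneg (by linarith : (0:ℝ) ≤ n + 1)
          (by linarith : (0:ℝ) ≤ n + 3)) this.le]
      exact le_of_mul_le_mul_left (h2.trans h3) (by positivity)

/-- The equation satisfied by `f` when `u = ζ f` solves an equation with exponents `-2` and `1`
at `ζ = 0`: the recursion for the Taylor coefficients has the factor `n (n + 3)`, which vanishes
for no `n ≥ 1`, so a convergent solution exists. -/
theorem exists_frobenius_solution {σ : ℂ → ℂ} (hσ : AnalyticAt ℂ σ 0) :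
    ∃ f : ℂ → ℂ, AnalyticAt ℂ f 0 ∧ f 0 = 1 ∧
      ∀ᶠ ζ in 𝓝 (0 : ℂ), ζ * deriv (deriv f) ζ + 4 * deriv f ζ = σ ζ * f ζ := by
  obtain ⟨M, t, hM, ht, hb⟩ := exists_norm_taylorCoeff_le hσ
  obtain ⟨f, hf, hfc⟩ := exists_analyticAt_taylorCoeff_eq (lt_max_of_lt_left hM)
    (norm_frobeniusCoeff_le hM ht hb (le_max_left M t) (le_max_right M t))
  refine ⟨f, hf, ?_, ?_⟩
  · rw [← taylorCoeff_zero f, hfc, frobeniusCoeff]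
  · have h1 : AnalyticAt ℂ (fun ζ => ζ * deriv (deriv f) ζ) 0 := analyticAt_id.mul hf.deriv.deriv
    have h2 : AnalyticAt ℂ (fun ζ => 4 * deriv f ζ) 0 := analyticAt_const.mul hf.deriv
    refine eventuallyEq_of_taylorCoeff_eq (h1.add h2) (hσ.mul hf) fun n => ?_
    have h3 : taylorCoeff (fun ζ => ζ * deriv (deriv f) ζ) n
        = n * ((n + 1) * taylorCoeff f (n + 1)) := by
      cases n with
      | zero => simp [taylorCoeff_id_mul_zero]
      | succ n =>
        rw [taylorCoeff_id_mul hf.deriv.deriv, taylorCoeff_deriv, taylorCoeff_deriv]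
        push_cast; ring
    refine (taylorCoeff_add h1 h2 n).trans (Eq.trans ?_ (taylorCoeff_mul hσ hf n).symm)
    rw [h3, taylorCoeff_const_mul, taylorCoeff_deriv]
    simp only [hfc]
    rw [← frobeniusCoeff_succ]
    ring

end LinODE

namespace LinODE

theorem taylorCoeff_cubic {σ R : ℂ → ℂ} {a b c : ℂ} (hR : AnalyticAt ℂ R 0)
    (h : ∀ ζ, σ ζ = a + b * ζ + c * ζ ^ 2 + ζ ^ 3 * R ζ) :
    taylorCoeff σ 0 = a ∧ taylorCoeff σ 1 = b ∧ taylorCoeff σ 2 = c := by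
  have e : σ = fun ζ => a + ζ * (b + ζ * (c + ζ * R ζ)) := by
    funext ζ; rw [h]; ring
  subst e
  refine ⟨?_, ?_, ?_⟩
  · simp [taylorCoeff_zero]
  · rw [taylorCoeff_add analyticAt_const (by fun_prop), taylorCoeff_id_mul (by fun_prop)]
    simp [taylorCoeff_zero, taylorCoeff_const]
  · rw [taylorCoeff_add analyticAt_const (by fun_prop), taylorCoeff_id_mul (by fun_prop),
      taylorCoeff_add analyticAt_const (by fun_prop), taylorCoeff_id_mul (by fun_prop)]
    simp [taylorCoeff_zero, taylorCoeff_const]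

/-- The coefficient of the logarithm in terms of the first Taylor coefficients of `σ`: those of
`f` are found from the equation, those of `1 / f²` from `(1 / f²) f f = 1`. -/
theorem taylorCoeff_three_one_div_sq {σ f : ℂ → ℂ} (hσ : AnalyticAt ℂ σ 0)
    (hf : AnalyticAt ℂ f 0) (hf0 : f 0 = 1)
    (hode : ∀ᶠ ζ in 𝓝 (0 : ℂ), ζ * deriv (deriv f) ζ + 4 * deriv f ζ = σ ζ * f ζ) :
    taylorCoeff (fun ζ => 1 / f ζ ^ 2) 3 =
      -taylorCoeff σ 2 / 9 + taylorCoeff σ 0 * taylorCoeff σ 1 / 9 - taylorCoeff σ 0 ^ 3 / 36 := by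
  have hh : AnalyticAt ℂ (fun ζ => 1 / f ζ ^ 2) 0 :=
    analyticAt_const.div (hf.pow 2) (by simp [hf0])
  have hf' := hf.deriv
  have hf'' := hf'.deriv
  have h1 : AnalyticAt ℂ (fun ζ => ζ * deriv (deriv f) ζ) 0 := by fun_prop
  have h2 : AnalyticAt ℂ (fun ζ => 4 * deriv f ζ) 0 := by fun_prop
  have e (n : ℕ) := (taylorCoeff_add h1 h2 n).symm.trans ((taylorCoeff_congr hode n).trans
    (taylorCoeff_mul hσ hf n))
  have e0 := e 0
  have e1 := e 1
  have e2 := e 2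
  simp only [taylorCoeff_id_mul hf'', taylorCoeff_id_mul_zero, taylorCoeff_const_mul,
    taylorCoeff_deriv, Finset.sum_range_succ, Finset.sum_range_zero] at e0 e1 e2
  have hmul : (fun ζ => (1 / f ζ ^ 2) * (f ζ * f ζ)) =ᶠ[𝓝 0] fun _ => 1 := by
    filter_upwards [hf.continuousAt.eventually_ne (by simp [hf0] : f 0 ≠ 0)] with ζ hζ
    field_simp
  have g (n : ℕ) := (taylorCoeff_mul hh (hf.fun_mul hf) n).symm.trans
    ((taylorCoeff_congr hmul n).trans (taylorCoeff_const 1 n))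
  have g0 := g 0
  have g1 := g 1
  have g2 := g 2
  have g3 := g 3
  simp only [taylorCoeff_mul hf hf, Finset.sum_range_succ, Finset.sum_range_zero] at g0 g1 g2 g3
  have hf0' : taylorCoeff f 0 = 1 := by rw [taylorCoeff_zero, hf0]
  generalize taylorCoeff (fun ζ => 1 / f ζ ^ 2) = h at *
  generalize taylorCoeff f = F at *
  generalize taylorCoeff σ = s at *
  norm_num [hf0'] at e0 e1 e2 g0 g1 g2 g3
  have f1 : F 1 = s 0 / 4 := by linear_combination e0 / 4
  have f2 : F 2 = (s 0 ^ 2 / 4 + s 1) / 10 := by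
    rw [f1] at e1; linear_combination e1 / 10
  have f3 : F 3 = (s 0 * F 2 + s 1 * F 1 + s 2) / 18 := by
    linear_combination e2 / 18
  have h1 : h 1 = -2 * F 1 := by rw [g0] at g1; linear_combination g1
  have h2 : h 2 = -2 * F 2 + 3 * F 1 ^ 2 := by
    rw [g0, h1] at g2; linear_combination g2
  rw [g0, h1, h2, f3, f2, f1] at g3
  linear_combination g3

/-- Termwise solution of `ζ H' - 3 H = h - h₃ ζ³`; the monomial `ζ³`, which lies in the kernel of
the left-hand side, is the one obstruction. -/
theorem exists_analyticAt_id_mul_deriv_sub {h : ℂ → ℂ} (hh : AnalyticAt ℂ h 0) :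
    ∃ H : ℂ → ℂ, AnalyticAt ℂ H 0 ∧
      ∀ᶠ ζ in 𝓝 (0 : ℂ), ζ * deriv H ζ - 3 * H ζ = h ζ - taylorCoeff h 3 * ζ ^ 3 := by
  obtain ⟨F, hF, hsum⟩ := hh.exists_eq_sum_add_pow_mul 4
  obtain ⟨ρ, hρ, hball⟩ := Metric.eventually_nhds_iff_ball.mp hF.eventually_analyticAt
  obtain ⟨K, hK⟩ := DifferentiableOn.isExactOn_ball (f := F) (c := 0) (r := ρ)
    fun z hz => (hball z hz).differentiableAt.differentiableWithinAt
  have hKa : AnalyticAt ℂ K 0 := by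
    refine DifferentiableOn.analyticAt (s := Metric.ball 0 ρ)
      (fun z hz => (hK z hz).differentiableAt.differentiableWithinAt) (Metric.ball_mem_nhds _ hρ)
  refine ⟨fun ζ => -taylorCoeff h 0 / 3 - taylorCoeff h 1 / 2 * ζ - taylorCoeff h 2 * ζ ^ 2
    + ζ ^ 3 * K ζ, by fun_prop, ?_⟩
  filter_upwards [Metric.ball_mem_nhds (0 : ℂ) hρ] with ζ hζ
  have hd : HasDerivAt (fun ζ => -taylorCoeff h 0 / 3 - taylorCoeff h 1 / 2 * ζ
      - taylorCoeff h 2 * ζ ^ 2 + ζ ^ 3 * K ζ)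
      (0 - taylorCoeff h 1 / 2 * 1 - taylorCoeff h 2 * (2 * ζ ^ 1 * 1)
        + (3 * ζ ^ 2 * 1 * K ζ + ζ ^ 3 * F ζ)) ζ :=
    ((((hasDerivAt_const ζ _).sub ((hasDerivAt_id ζ).const_mul _)).sub
      (((hasDerivAt_id ζ).pow 2).const_mul _)).add (((hasDerivAt_id ζ).pow 3).mul (hK ζ hζ)))
  rw [hd.deriv, hsum ζ]
  simp only [taylorCoeff, Finset.sum_range_succ, Finset.sum_range_zero, smul_eq_mul]
  norm_num [Nat.factorial]
  ring

end LinODE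

namespace Satellite

open LinODE

/-! ### The coefficient of the reduced equation near infinity -/

theorem omega_pos {C : ℝ} (hC : C ≠ 1) : 0 < omega C :=
  Real.sqrt_pos.mpr (mul_pos three_pos (abs_pos.mpr (sub_ne_zero.mpr hC)))

theorem omega_sq (C : ℝ) : omega C ^ 2 = 3 * |C - 1| :=
  Real.sq_sqrt (by positivity)

theorem kPrime_sq {k : ℝ} (hk₀ : 0 < k) (hk₁ : k < 1) : kPrime k ^ 2 = 1 - k ^ 2 :=
  Real.sq_sqrt (by nlinarith)

/-- `1 / ((1 - k² ζ²) (1 + k'² ζ²)) = 1 + (k² - k'²) ζ² + O(ζ⁴)`. -/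
theorem exists_inv_quartic_eq (u v : ℂ) :
    ∃ G : ℂ → ℂ, AnalyticAt ℂ G 0 ∧ ∀ᶠ ζ in 𝓝 (0 : ℂ),
      (1 - u * ζ ^ 2) * (1 + v * ζ ^ 2) ≠ 0 ∧
      1 / ((1 - u * ζ ^ 2) * (1 + v * ζ ^ 2)) = 1 + (u - v) * ζ ^ 2 + ζ ^ 4 * G ζ := by
  have hD : ContinuousAt (fun ζ : ℂ => (1 - u * ζ ^ 2) * (1 + v * ζ ^ 2)) 0 := by fun_prop
  refine ⟨fun ζ => ((u - v) ^ 2 + u * v + (u - v) * (u * v) * ζ ^ 2) /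
    ((1 - u * ζ ^ 2) * (1 + v * ζ ^ 2)), ?_, ?_⟩
  · exact AnalyticAt.div (by fun_prop) (by fun_prop) (by simp)
  · filter_upwards [hD.eventually_ne (by simp : _ ≠ (0 : ℂ))] with ζ hζ
    refine ⟨hζ, ?_⟩
    rw [div_eq_iff hζ, add_mul _ (ζ ^ 4 * _), mul_assoc (ζ ^ 4), div_mul_cancel₀ _ hζ]
    ring

theorem p_inv {k : ℝ} {ζ : ℂ} (hζ : ζ ≠ 0)
    (hk : (kPrime k : ℂ) ^ 2 = 1 - (k : ℂ) ^ 2) :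
    p k ζ⁻¹ = ζ * ((2 - ((k : ℂ) ^ 2 - (kPrime k : ℂ) ^ 2) * ζ ^ 2) *
      (1 / ((1 - (k : ℂ) ^ 2 * ζ ^ 2) * (1 + (kPrime k : ℂ) ^ 2 * ζ ^ 2)))) := by
  have h1 : (k : ℂ) ^ 2 - ζ⁻¹ ^ 2 = -(1 - (k : ℂ) ^ 2 * ζ ^ 2) / ζ ^ 2 := by field_simp; ring
  have h2 : ζ⁻¹ ^ 2 + (kPrime k : ℂ) ^ 2 = (1 + (kPrime k : ℂ) ^ 2 * ζ ^ 2) / ζ ^ 2 := by field_simp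
  rw [p, h1, h2, hk]
  -- at the poles both sides are zero, by the convention for division
  by_cases h3 : 1 - (k : ℂ) ^ 2 * ζ ^ 2 = 0
  · simp [h3]
  by_cases h4 : 1 + (1 - (k : ℂ) ^ 2) * ζ ^ 2 = 0
  · simp [h4]
  field_simp
  ring

/-- The constant term of the numerator of `q`; its terms in `z²` and `z` are `2 ω² z²` and `2 ω z`
for either sign of `C - 1`. -/
noncomputable def qConst (C ξ k : ℝ) : ℝ :=
  if C < 1 then 1 - ξ + omega C ^ 2 * kPrime k ^ 2 else 1 - ξ - omega C ^ 2 * k ^ 2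

theorem q_inv {C ξ k : ℝ} {ζ : ℂ} (hζ : ζ ≠ 0) (hω : (omega C : ℂ) ≠ 0) :
    -q C ξ k ζ⁻¹ = ζ ^ 2 * ((2 + 2 / omega C * ζ + qConst C ξ k / omega C ^ 2 * ζ ^ 2) *
      (1 / ((1 - (k : ℂ) ^ 2 * ζ ^ 2) * (1 + (kPrime k : ℂ) ^ 2 * ζ ^ 2)))) := by
  have h1 : (k : ℂ) ^ 2 - ζ⁻¹ ^ 2 = -(1 - (k : ℂ) ^ 2 * ζ ^ 2) / ζ ^ 2 := by field_simp; ring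
  have h2 : ζ⁻¹ ^ 2 + (kPrime k : ℂ) ^ 2 = (1 + (kPrime k : ℂ) ^ 2 * ζ ^ 2) / ζ ^ 2 := by field_simp
  have key : q C ξ k ζ⁻¹ = (2 * omega C ^ 2 * ζ⁻¹ ^ 2 + 2 * omega C * ζ⁻¹ + qConst C ξ k) /
      ((omega C : ℂ) ^ 2 * ((k : ℂ) ^ 2 - ζ⁻¹ ^ 2) * (ζ⁻¹ ^ 2 + (kPrime k : ℂ) ^ 2)) := by
    rw [q, qConst]
    split_ifs
    · congr 1; push_cast; ring
    · congr 1; push_cast; ring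
  rw [key, h1, h2]
  -- at the poles both sides are zero, by the convention for division
  by_cases h3 : 1 - (k : ℂ) ^ 2 * ζ ^ 2 = 0
  · simp [h3]
  by_cases h4 : 1 + (kPrime k : ℂ) ^ 2 * ζ ^ 2 = 0
  · simp [h4]
  field_simp

/-- The expansion of `r` at infinity. -/
theorem exists_r_inv_eq {C ξ k : ℝ} (hk₀ : 0 < k) (hk₁ : k < 1) (hC : C ≠ 1) :
    ∃ R : ℂ → ℂ, AnalyticAt ℂ R 0 ∧ ∀ᶠ ζ in 𝓝[≠] (0 : ℂ),
      r C ξ k ζ⁻¹ = ζ ^ 2 * (2 + ζ * ((2 / omega C : ℝ)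
        + (qConst C ξ k / omega C ^ 2 + 3 / 2 * (k ^ 2 - kPrime k ^ 2) : ℝ) * ζ
        + (2 * (k ^ 2 - kPrime k ^ 2) / omega C : ℝ) * ζ ^ 2 + ζ ^ 3 * R ζ)) := by
  have hω : (omega C : ℂ) ≠ 0 := by exact_mod_cast (omega_pos hC).ne'
  have hk : (kPrime k : ℂ) ^ 2 = 1 - (k : ℂ) ^ 2 := by exact_mod_cast kPrime_sq hk₀ hk₁
  obtain ⟨G, hG, hGe⟩ := exists_inv_quartic_eq ((k : ℂ) ^ 2) ((kPrime k : ℂ) ^ 2)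
  set m : ℂ := (k : ℂ) ^ 2 - (kPrime k : ℂ) ^ 2 with hm
  -- `G₂` is the remainder in `p (1 / ζ) = ζ (2 + m ζ² + ζ⁴ G₂)`
  set G₂ : ℂ → ℂ := fun ζ => -m ^ 2 + (2 - m * ζ ^ 2) * G ζ with hG₂
  have hG₂a : AnalyticAt ℂ G₂ 0 := by fun_prop
  have hG₂d : AnalyticAt ℂ (deriv G₂) 0 := hG₂a.deriv
  set s : ℂ := qConst C ξ k / omega C ^ 2 with hs
  refine ⟨fun ζ => s * m + (2 + 2 / omega C * ζ + s * ζ ^ 2) * G ζ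
    - (1 / 2) * (5 * G₂ ζ + ζ * deriv G₂ ζ)
    + (m ^ 2 / 4 + G₂ ζ + m * ζ ^ 2 * G₂ ζ / 2 + ζ ^ 4 * G₂ ζ ^ 2 / 4), by fun_prop, ?_⟩
  have hp : ∀ᶠ ζ in 𝓝[≠] (0 : ℂ), p k ζ⁻¹ = ζ * (2 + m * ζ ^ 2 + ζ ^ 4 * G₂ ζ) := by
    filter_upwards [hGe.filter_mono nhdsWithin_le_nhds, self_mem_nhdsWithin] with ζ hζ hζ0
    rw [p_inv hζ0 hk, hζ.2, hG₂]
    ring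
  have hp' : ∀ᶠ ζ in 𝓝[≠] (0 : ℂ), ∀ᶠ w in 𝓝 ζ, p k w⁻¹ = w * (2 + m * w ^ 2 + w ^ 4 * G₂ w) :=
    (eventually_eventually_nhdsWithin.mpr hp).mp <| by
      filter_upwards [self_mem_nhdsWithin] with ζ hζ0 h
      rwa [isOpen_compl_singleton.nhdsWithin_eq hζ0] at h
  filter_upwards [hGe.filter_mono nhdsWithin_le_nhds, self_mem_nhdsWithin, hp', hp,
    hG₂a.eventually_analyticAt.filter_mono nhdsWithin_le_nhds] with ζ hζ hζ0 hpe hpζ hGan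
  have hζ0' : ζ ≠ 0 := hζ0
  have hd : HasDerivAt (fun w => w * (2 + m * w ^ 2 + w ^ 4 * G₂ w))
      (1 * (2 + m * ζ ^ 2 + ζ ^ 4 * G₂ ζ) + ζ * (m * (2 * ζ ^ 1 * 1)
        + (4 * ζ ^ 3 * 1 * G₂ ζ + ζ ^ 4 * deriv G₂ ζ))) ζ :=
    (hasDerivAt_id ζ).mul (((((hasDerivAt_id ζ).pow 2).const_mul m).const_add 2).add
      (((hasDerivAt_id ζ).pow 4).mul hGan.differentiableAt.hasDerivAt))
  have hinv : Tendsto (fun z : ℂ => z⁻¹) (𝓝 ζ⁻¹) (𝓝 ζ) := by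
    simpa using tendsto_inv₀ (inv_ne_zero hζ0')
  have hcomp : p k =ᶠ[𝓝 ζ⁻¹] fun z => (fun w => w * (2 + m * w ^ 2 + w ^ 4 * G₂ w)) z⁻¹ := by
    filter_upwards [hinv.eventually hpe] with z hz
    simpa using hz
  have hderiv : deriv (p k) ζ⁻¹ = -ζ ^ 2 * (1 * (2 + m * ζ ^ 2 + ζ ^ 4 * G₂ ζ)
      + ζ * (m * (2 * ζ ^ 1 * 1) + (4 * ζ ^ 3 * 1 * G₂ ζ + ζ ^ 4 * deriv G₂ ζ))) := by
    rw [hcomp.deriv_eq]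
    have h := HasDerivAt.comp (ζ⁻¹) (h₂ := fun w => w * (2 + m * w ^ 2 + w ^ 4 * G₂ w))
      (by rw [inv_inv]; exact hd) (hasDerivAt_inv (inv_ne_zero hζ0'))
    refine h.deriv.trans ?_
    field_simp
  rw [r, hderiv, hpζ, q_inv hζ0' hω, hζ.2]
  push_cast
  rw [← hm, ← hs]
  field_simp
  ring

/-- The value of the coefficient of the logarithm; the dependence on `k` cancels by
`k² + k'² = 1`. -/
theorem logCoeff_eq {C ξ k a b c : ℝ} (hk₀ : 0 < k) (hk₁ : k < 1) (hC : C ≠ 1)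
    (ha : a = 2 / omega C)
    (hb : b = qConst C ξ k / omega C ^ 2 + 3 / 2 * (k ^ 2 - kPrime k ^ 2))
    (hc : c = 2 * (k ^ 2 - kPrime k ^ 2) / omega C) :
    -c / 9 + a * b / 9 - a ^ 3 / 36 =
      ((if C < 1 then omega C ^ 2 else -omega C ^ 2) - 2 * ξ) / (9 * omega C ^ 3) := by
  have hω := (omega_pos hC).ne'
  have hk := kPrime_sq hk₀ hk₁
  subst ha hb hc
  rw [qConst]
  split_ifs
  · rw [hk]; field_simp; ring
  · rw [hk]; field_simp; ring

theorem logCoeff_ne_zero {C ξ : ℝ} (hC : C ≠ 1) (hξ : 2 * ξ ≠ 3 * (1 - C)) :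
    ((if C < 1 then omega C ^ 2 else -omega C ^ 2) - 2 * ξ) / (9 * omega C ^ 3) ≠ 0 := by
  have hω := omega_pos hC
  refine div_ne_zero ?_ (by positivity)
  rw [omega_sq]
  split_ifs with h
  · rw [abs_of_neg (by linarith)]
    intro h'; exact hξ (by linarith)
  · rw [abs_of_nonneg (by linarith)]
    intro h'; exact hξ (by linarith)

end Satellite

namespace LinODE

/-! ### Exponents at infinity -/

/-- The limits `A 0` and `B 0` in the indicial equation are determined by the coefficients, and
equal `2` and `-2`. -/
theorem setOf_isExponentAtInfty_eq {r σ : ℂ → ℂ} (hσ : AnalyticAt ℂ σ 0)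
    (hr : ∀ᶠ ζ in 𝓝[≠] (0 : ℂ), r ζ⁻¹ = ζ ^ 2 * (2 + ζ * σ ζ)) :
    {ρ : ℂ | IsExponentAtInfty 0 (fun z => -r z) ρ} = {-2, 1} := by
  have hB : AnalyticAt ℂ (fun ζ => -(2 + ζ * σ ζ)) 0 := by fun_prop
  have key : ∀ᶠ ζ in 𝓝[≠] (0 : ℂ), ζ * (2 / ζ - (0 : ℂ → ℂ) (1 / ζ) / ζ ^ 2) = 2 ∧
      ζ ^ 2 * (-r (1 / ζ) / ζ ^ 4) = -(2 + ζ * σ ζ) := by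
    filter_upwards [hr, self_mem_nhdsWithin] with ζ h hζ
    have hζ' : ζ ≠ 0 := hζ
    rw [one_div, h]
    constructor
    · simp [mul_div_cancel₀ _ hζ']
    · field_simp
  have hpoly (ρ : ℂ) : ρ * (ρ - 1) + 2 * ρ + -2 = 0 ↔ ρ = -2 ∨ ρ = 1 := by
    rw [show ρ * (ρ - 1) + 2 * ρ + -2 = (ρ + 2) * (ρ - 1) by ring, mul_eq_zero, sub_eq_zero,
      add_eq_zero_iff_eq_neg]
  ext ρ
  simp only [Set.mem_ofPred_eq, Set.mem_insert_iff, Set.mem_singleton_iff, ← hpoly]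
  constructor
  · rintro ⟨A, B, hA, hB', hAB, h⟩
    have h1 : A =ᶠ[𝓝[≠] 0] fun _ => 2 := by
      filter_upwards [hAB, key] with ζ h1 h2 using h1.1.symm.trans h2.1
    have h2 : B =ᶠ[𝓝[≠] 0] fun ζ => -(2 + ζ * σ ζ) := by
      filter_upwards [hAB, key] with ζ h1 h2 using h1.2.symm.trans h2.2
    rw [hA.continuousAt.eventuallyEq_nhds_iff_eventuallyEq_nhdsNE continuousAt_const] at h1
    rw [hB'.continuousAt.eventuallyEq_nhds_iff_eventuallyEq_nhdsNE hB.continuousAt] at h2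
    rw [h1.eq_of_nhds, h2.eq_of_nhds] at h
    simpa using h
  · intro h
    exact ⟨fun _ => 2, _, analyticAt_const, hB, key, by simpa using h⟩

/-! ### Fundamental systems near infinity -/

theorem isSolutionNear_of_hasDerivAt {r u du : ℂ → ℂ} {z₀ : ℂ}
    (h : ∀ᶠ z in 𝓝 z₀, HasDerivAt u (du z) z ∧ HasDerivAt du (r z * u z) z) :
    IsSolutionNear 0 (fun z => -r z) u z₀ := by
  refine ⟨Complex.analyticAt_iff_eventually_differentiableAt.mpr
    (h.mono fun z hz => hz.1.differentiableAt), ?_⟩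
  filter_upwards [h.eventually_nhds] with z hz
  have e : deriv u =ᶠ[𝓝 z] du := hz.mono fun w hw => hw.1.deriv
  rw [e.deriv_eq, hz.self_of_nhds.2.deriv]
  simp

theorem IsSolutionNear.const_mul {p q w : ℂ → ℂ} {z₀ : ℂ} (c : ℂ)
    (h : IsSolutionNear p q w z₀) : IsSolutionNear p q (fun z => c * w z) z₀ := by
  refine ⟨analyticAt_const.mul h.1, ?_⟩
  filter_upwards [h.2] with z hz
  have e : deriv (fun z => c * w z) = fun z => c * deriv w z := by
    funext z; exact deriv_const_mul_field c
  rw [e, deriv_const_mul_field]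
  linear_combination c * hz

theorem IsFundamentalSystem.const_mul_left {p q u v : ℂ → ℂ} {z₀ c : ℂ} (hc : c ≠ 0)
    (h : IsFundamentalSystem p q ![u, v] z₀) :
    IsFundamentalSystem p q ![fun z => c * u z, v] z₀ := by
  obtain ⟨hs, hd⟩ := h
  refine ⟨Fin.forall_fin_two.mpr ⟨(hs 0).const_mul c, hs 1⟩, ?_⟩
  simp only [fundamentalMatrix, Matrix.det_fin_two_of, Matrix.cons_val_zero,
    Matrix.cons_val_one, deriv_const_mul_field] at hd ⊢
  intro h0
  exact mul_ne_zero hc hd (by linear_combination h0)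

/-- The conditions at the point `z`, with `ζ = 1 / z`, under which `ζ f(ζ)` and its product with
`g ln ζ + ζ⁻³ H(ζ)` solve `W'' = r W`. -/
structure IsFrobeniusDataAt (r σ f H : ℂ → ℂ) (g z : ℂ) : Prop where
  ne_zero : z ≠ 0
  analyticAt_σ : AnalyticAt ℂ σ z⁻¹
  analyticAt_f : AnalyticAt ℂ f z⁻¹
  analyticAt_H : AnalyticAt ℂ H z⁻¹
  f_ne_zero : f z⁻¹ ≠ 0
  r_eq : r z = z⁻¹ ^ 2 * (2 + z⁻¹ * σ z⁻¹)
  f_eq : z⁻¹ * deriv (deriv f) z⁻¹ + 4 * deriv f z⁻¹ = σ z⁻¹ * f z⁻¹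
  H_eq : z⁻¹ * deriv H z⁻¹ - 3 * H z⁻¹ = 1 / f z⁻¹ ^ 2 - g * z⁻¹ ^ 3

/-- Conditions holding near `ζ = 0` hold on a whole exterior domain `‖z‖ > R`. -/
theorem exists_isFrobeniusDataAt {r σ f H : ℂ → ℂ} {g : ℂ} (hσ : AnalyticAt ℂ σ 0)
    (hf : AnalyticAt ℂ f 0) (hH : AnalyticAt ℂ H 0) (hf0 : f 0 = 1)
    (hr : ∀ᶠ ζ in 𝓝[≠] (0 : ℂ), r ζ⁻¹ = ζ ^ 2 * (2 + ζ * σ ζ))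
    (hode : ∀ᶠ ζ in 𝓝 (0 : ℂ), ζ * deriv (deriv f) ζ + 4 * deriv f ζ = σ ζ * f ζ)
    (hHe : ∀ᶠ ζ in 𝓝 (0 : ℂ), ζ * deriv H ζ - 3 * H ζ = 1 / f ζ ^ 2 - g * ζ ^ 3) :
    ∃ R : ℝ, 0 < R ∧ ∀ z : ℂ, R < ‖z‖ → IsFrobeniusDataAt r σ f H g z := by
  have hall := ((((hσ.eventually_analyticAt.and hf.eventually_analyticAt).and
    hH.eventually_analyticAt).and (hf.continuousAt.eventually_ne (by simp [hf0] : f 0 ≠ 0))).and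
    hode).and (hHe.and (eventually_nhdsWithin_iff.mp hr))
  obtain ⟨δ, hδ, hball⟩ := Metric.eventually_nhds_iff.mp hall
  refine ⟨δ⁻¹, inv_pos.mpr hδ, fun z hz => ?_⟩
  have hz0 : z ≠ 0 := norm_pos_iff.mp ((inv_pos.mpr hδ).trans hz)
  obtain ⟨⟨⟨⟨⟨h1, h2⟩, h3⟩, h4⟩, h5⟩, h6, h7⟩ := hball (y := z⁻¹) (by
    rw [dist_zero_right, norm_inv]
    exact inv_lt_of_inv_lt₀ hδ hz)
  exact ⟨hz0, h1, h2, h3, h4, by simpa using h7 (inv_ne_zero hz0), h5, h6⟩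

namespace IsFrobeniusDataAt

variable {r σ f H : ℂ → ℂ} {g z : ℂ}

theorem analyticAt_first (h : IsFrobeniusDataAt r σ f H g z) :
    AnalyticAt ℂ (fun z => z⁻¹ * f z⁻¹) z :=
  have hinv : AnalyticAt ℂ (fun z : ℂ => z⁻¹) z := analyticAt_inv h.ne_zero
  hinv.mul (h.analyticAt_f.comp hinv)

/-- Holomorphy of the single-valued part of the second solution. -/
theorem analyticAt_second (h : IsFrobeniusDataAt r σ f H g z) :
    AnalyticAt ℂ (fun z => z ^ 2 * (f z⁻¹ * H z⁻¹)) z :=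
  have hinv : AnalyticAt ℂ (fun z : ℂ => z⁻¹) z := analyticAt_inv h.ne_zero
  (analyticAt_id.pow 2).mul ((h.analyticAt_f.comp hinv).mul (h.analyticAt_H.comp hinv))

theorem hasDerivAt_inv' (h : IsFrobeniusDataAt r σ f H g z) :
    HasDerivAt (fun z : ℂ => z⁻¹) (-(z⁻¹ ^ 2)) z := by
  simpa using hasDerivAt_inv h.ne_zero

theorem hasDerivAt_first (h : IsFrobeniusDataAt r σ f H g z) :
    HasDerivAt (fun z => z⁻¹ * f z⁻¹) (-(z⁻¹ ^ 2 * (f z⁻¹ + z⁻¹ * deriv f z⁻¹))) z := by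
  have hi := h.hasDerivAt_inv'
  convert! hi.mul (h.analyticAt_f.differentiableAt.hasDerivAt.comp z hi) using 1
  simp only [Function.comp_apply]
  ring

theorem hasDerivAt_deriv_first (h : IsFrobeniusDataAt r σ f H g z) :
    HasDerivAt (fun z => -(z⁻¹ ^ 2 * (f z⁻¹ + z⁻¹ * deriv f z⁻¹))) (r z * (z⁻¹ * f z⁻¹)) z := by
  have hi := h.hasDerivAt_inv'
  have hf := h.analyticAt_f.differentiableAt.hasDerivAt.comp z hi
  have hf' := h.analyticAt_f.deriv.differentiableAt.hasDerivAt.comp z hi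
  convert! ((hi.pow 2).mul (hf.add (hi.mul hf'))).neg using 1
  simp only [Function.comp_apply, Pi.add_apply, Pi.mul_apply, Pi.pow_apply]
  rw [h.r_eq]
  push_cast
  linear_combination -z⁻¹ ^ 4 * h.f_eq

/-- The quotient of the second solution by the first one is a primitive of minus the inverse
square of the first. -/
theorem hasDerivAt_quotient (h : IsFrobeniusDataAt r σ f H g z) {l : ℂ → ℂ}
    (hl : HasDerivAt l (-z⁻¹) z) :
    HasDerivAt (fun z => g * l z + z ^ 3 * H z⁻¹) (-(z ^ 2 / f z⁻¹ ^ 2)) z := by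
  have hi := h.hasDerivAt_inv'
  have hH := h.analyticAt_H.differentiableAt.hasDerivAt.comp z hi
  convert! (hl.const_mul g).add (((hasDerivAt_id z).pow 3).mul hH) using 1
  have e := h.H_eq
  have hz := h.ne_zero
  simp only [Function.comp_apply, Pi.pow_apply, id]
  have e1 : deriv H z⁻¹ = z * (1 / f z⁻¹ ^ 2 - g * z⁻¹ ^ 3 + 3 * H z⁻¹) := by
    rw [← e]; field_simp; ring
  rw [e1]
  have := h.f_ne_zero
  field_simp
  push_cast
  ring

/-- The second solution is `v = u P` with `P' = -1 / u²`, so `v' = u' P - 1 / u` and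
`v'' = u'' P`; the Wronskian is `-1`. -/
theorem isFundamentalSystem {z₀ : ℂ} (h : ∀ᶠ z in 𝓝 z₀, IsFrobeniusDataAt r σ f H g z) {l : ℂ → ℂ}
    (hl : ∀ᶠ z in 𝓝 z₀, HasDerivAt l (-z⁻¹) z) :
    IsFundamentalSystem 0 (fun z => -r z)
      ![fun z => z⁻¹ * f z⁻¹,
        fun z => g * (z⁻¹ * f z⁻¹) * l z + z ^ 2 * (f z⁻¹ * H z⁻¹)] z₀ := by
  set u : ℂ → ℂ := fun z => z⁻¹ * f z⁻¹ with hu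
  set du : ℂ → ℂ := fun z => -(z⁻¹ ^ 2 * (f z⁻¹ + z⁻¹ * deriv f z⁻¹)) with hdu
  set P : ℂ → ℂ := fun z => g * l z + z ^ 3 * H z⁻¹ with hP
  set v : ℂ → ℂ := fun z => g * (z⁻¹ * f z⁻¹) * l z + z ^ 2 * (f z⁻¹ * H z⁻¹) with hv
  have huv : ∀ᶠ z in 𝓝 z₀, v =ᶠ[𝓝 z] fun z => u z * P z := by
    refine Filter.Eventually.eventually_nhds ?_
    filter_upwards [h] with z hz
    have := hz.ne_zero
    simp only [hv, hu, hP]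
    field_simp
  have hv' : ∀ᶠ z in 𝓝 z₀, HasDerivAt v (du z * P z - (u z)⁻¹) z := by
    filter_upwards [h, hl, huv] with z hz hlz huvz
    have := (hz.hasDerivAt_first.mul (hz.hasDerivAt_quotient hlz)).congr_of_eventuallyEq huvz
    convert! this using 1
    have h1 := hz.ne_zero
    have h2 := hz.f_ne_zero
    simp only [hdu, hu, hP]
    field_simp
    ring
  have hv'' : ∀ᶠ z in 𝓝 z₀, HasDerivAt (fun z => du z * P z - (u z)⁻¹) (r z * v z) z := by
    filter_upwards [h, hl, huv] with z hz hlz huvz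
    have h1 := hz.ne_zero
    have h2 := hz.f_ne_zero
    have hu0 : u z ≠ 0 := mul_ne_zero (inv_ne_zero h1) h2
    convert! (hz.hasDerivAt_deriv_first.mul (hz.hasDerivAt_quotient hlz)).sub
      (hz.hasDerivAt_first.fun_inv hu0) using 1
    have e : z ^ 2 / f z⁻¹ ^ 2 = 1 / u z ^ 2 := by
      simp only [hu]
      field_simp
    rw [huvz.eq_of_nhds, e]
    change r z * (u z * P z) = r z * u z * P z + du z * -(1 / u z ^ 2) - -du z / u z ^ 2
    ring
  refine ⟨Fin.forall_fin_two.mpr ⟨isSolutionNear_of_hasDerivAt (du := du) ?_,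
    isSolutionNear_of_hasDerivAt (hv'.and hv'')⟩, ?_⟩
  · exact h.mono fun z hz => ⟨hz.hasDerivAt_first, hz.hasDerivAt_deriv_first⟩
  · have h0 := h.self_of_nhds
    have hu0 : u z₀ ≠ 0 := mul_ne_zero (inv_ne_zero h0.ne_zero) h0.f_ne_zero
    have d1 : deriv u z₀ = du z₀ := h0.hasDerivAt_first.deriv
    have d2 := hv'.self_of_nhds.deriv
    simp only [fundamentalMatrix, Matrix.det_fin_two_of, Matrix.cons_val_zero,
      Matrix.cons_val_one, d1, d2, huv.self_of_nhds.eq_of_nhds]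
    have : u z₀ * (du z₀ * P z₀ - (u z₀)⁻¹) - u z₀ * P z₀ * du z₀ = -1 := by
      field_simp
      ring
    rw [this]
    simp

end IsFrobeniusDataAt

/-! ### Branches of the logarithm of `1 / z` and the monodromy -/

theorem hasDerivAt_of_exp_eq_inv {l : ℂ → ℂ} {z₀ : ℂ} (hl : AnalyticAt ℂ l z₀)
    (h : ∀ᶠ z in 𝓝 z₀, Complex.exp (l z) = z⁻¹) : ∀ᶠ z in 𝓝 z₀, HasDerivAt l (-z⁻¹) z := by
  filter_upwards [hl.eventually_analyticAt, h.eventually_nhds] with z hz he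
  have hz0 : z ≠ 0 := by
    rintro rfl
    simpa using he.self_of_nhds
  have h1 := hz.differentiableAt.hasDerivAt.cexp
  have h2 := (hasDerivAt_inv hz0).congr_of_eventuallyEq he
  have h3 := h1.unique h2
  rw [he.self_of_nhds] at h3
  have h4 : deriv l z = -z⁻¹ := by
    field_simp at h3 ⊢
    exact h3
  rw [← h4]
  exact hz.differentiableAt.hasDerivAt

/-- The branch of `ln (1 / z)` near `z = exp (-c)` that takes the value `c` at this point. -/
noncomputable def logInvBranch (c z : ℂ) : ℂ := c - Complex.log (z * Complex.exp c)

theorem exp_logInvBranch (c : ℂ) {z : ℂ} (hz : z ≠ 0) :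
    Complex.exp (logInvBranch c z) = z⁻¹ := by
  rw [logInvBranch, Complex.exp_sub, Complex.exp_log (mul_ne_zero hz (Complex.exp_ne_zero c))]
  have := Complex.exp_ne_zero c
  field_simp

theorem analyticAt_logInvBranch {c z : ℂ} (h : Complex.exp c = z⁻¹) (hz : z ≠ 0) :
    AnalyticAt ℂ (logInvBranch c) z := by
  refine analyticAt_const.sub (AnalyticAt.clog (analyticAt_id.mul analyticAt_const) ?_)
  simp [h, hz]

theorem logInvBranch_add_two_pi_I (c z : ℂ) :
    logInvBranch (c + 2 * Real.pi * Complex.I) z = logInvBranch c z + 2 * Real.pi * Complex.I := by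
  rw [logInvBranch, Complex.exp_periodic c, logInvBranch]
  ring

/-- Branches with nearby values at `c` and `d` coincide close to `exp (-c)`, where the principal
logarithm does not cross its cut. -/
theorem logInvBranch_eq {c d z : ℂ} (hcd : |(d - c).im| < Real.pi / 2)
    (hz : 0 < (z * Complex.exp c).re) : logInvBranch c z = logInvBranch d z := by
  have hne : z * Complex.exp c ≠ 0 := by
    intro h; simp [h] at hz
  have harg := Complex.abs_arg_lt_pi_div_two_iff.mpr (Or.inl hz)
  rw [abs_lt] at hcd harg
  have e : z * Complex.exp d = Complex.exp (Complex.log (z * Complex.exp c) + (d - c)) := by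
    rw [Complex.exp_add, Complex.exp_log hne, Complex.exp_sub]
    have := Complex.exp_ne_zero c
    field_simp
  rw [logInvBranch, logInvBranch, e, Complex.log_exp]
  · ring
  · rw [Complex.add_im, Complex.log_im]; linarith [hcd.1, harg.1]
  · rw [Complex.add_im, Complex.log_im]; linarith [hcd.2, harg.2]

/-- Along a loop which increases `ln (1 / z)` by `2 π i`, the pair `(g u, g u ln (1 / z) + v)`
with `u`, `v` single valued takes on the matrix `[[1, 2 π i], [0, 1]]`. -/
theorem hasMonodromyAlong_logInvBranch {u v : ℂ → ℂ} (g : ℂ) {z₀ c : ℂ} {γ : Path z₀ z₀}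
    (hu : ∀ t, AnalyticAt ℂ u (γ t)) (hv : ∀ t, AnalyticAt ℂ v (γ t)) (hγ0 : ∀ t, γ t ≠ 0)
    (hc : Complex.exp c = z₀⁻¹) (hγ : EncirclesInftyOnce γ) :
    HasMonodromyAlong ![fun z => g * u z, fun z => g * u z * logInvBranch c z + v z] γ
      !![1, 2 * Real.pi * Complex.I; 0, 1] := by
  obtain ⟨L₀, hL₀, hL₀1⟩ := hγ
  -- the continuous logarithm along the loop, shifted to start at `c`
  set L : unitInterval → ℂ := fun t => L₀ t + (c - L₀ 0) with hL
  have hLc : Continuous L := by fun_prop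
  have hexp (t) : Complex.exp (L t) = (γ t)⁻¹ := by
    have h0 := hL₀ 0
    rw [γ.source] at h0
    rw [hL, Complex.exp_add, Complex.exp_sub, hc, h0, div_self, mul_one, hL₀]
    rw [← hc]; exact Complex.exp_ne_zero c
  have hL0 : L 0 = c := by simp [hL]
  have hL1 : L 1 = c + 2 * Real.pi * Complex.I := by simp only [hL, hL₀1]; ring
  refine ⟨fun t => ![fun z => g * u z, fun z => g * u z * logInvBranch (L t) z + v z],
    Fin.forall_fin_two.mpr ⟨fun t => ⟨analyticAt_const.mul (hu t), ?_⟩, fun t => ⟨?_, ?_⟩⟩,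
    Fin.forall_fin_two.mpr ⟨EventuallyEq.rfl, ?_⟩, Fin.forall_fin_two.mpr ⟨?_, ?_⟩⟩
  · exact Eventually.of_forall fun s => EventuallyEq.rfl
  · exact ((analyticAt_const.mul (hu t)).mul (analyticAt_logInvBranch (hexp t) (hγ0 t))).add (hv t)
  · have h1 : ∀ᶠ s in 𝓝 t, |(L t - L s).im| < Real.pi / 2 := by
      have hcont : ContinuousAt (fun s => |(L t - L s).im|) t := by fun_prop
      refine hcont.eventually_lt continuousAt_const ?_
      simp [Real.pi_pos]
    filter_upwards [h1] with s hs
    have h2 : ∀ᶠ z in 𝓝 (γ s), 0 < (z * Complex.exp (L s)).re := by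
      have hcont : ContinuousAt (fun z => (z * Complex.exp (L s)).re) (γ s) := by fun_prop
      refine continuousAt_const.eventually_lt hcont ?_
      simp [hexp, hγ0]
    filter_upwards [h2] with z hz
    change g * u z * logInvBranch (L s) z + v z = g * u z * logInvBranch (L t) z + v z
    rw [logInvBranch_eq hs hz]
  · simp [hL0]
  · exact Eventually.of_forall fun z => by simp [Fin.sum_univ_two]
  · refine Eventually.of_forall fun z => ?_
    simp only [Fin.sum_univ_two, Matrix.cons_val_one, Matrix.cons_val_zero, hL1,
      logInvBranch_add_two_pi_I, Matrix.of_apply, Matrix.cons_val', Matrix.cons_val_fin_one]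
    ring

end LinODE

/-! ### Exponents, solutions and monodromy of the reduced equation -/

theorem mainTheorem6 (C ξ k : ℝ) (hk₀ : 0 < k) (hk₁ : k < 1)
    (hC : C ≠ 1) (hξ : 2 * ξ ≠ 3 * (1 - C)) :
    -- the exponents of `W'' = r W` at infinity
    {ρ : ℂ | LinODE.IsExponentAtInfty 0 (fun z => -Satellite.r C ξ k z) ρ} = {-2, 1} ∧
    -- the solutions `W₁ = ζ f(ζ)`, `W₂ = g₃ W₁ log ζ + ζ⁻² V(ζ)`, where `ζ = 1 / z`
    (∃ f V : ℂ → ℂ, AnalyticAt ℂ f 0 ∧ f 0 = 1 ∧ AnalyticAt ℂ V 0 ∧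
      ∃ g₃ : ℂ, g₃ = LinODE.taylorCoeff (fun ζ => 1 / (f ζ) ^ 2) 3 ∧
        (C < 1 → g₃ = (((Satellite.omega C) ^ 2 - 2 * ξ) /
          (9 * (Satellite.omega C) ^ 3) : ℝ)) ∧
        (1 < C → g₃ = ((-(Satellite.omega C) ^ 2 - 2 * ξ) /
          (9 * (Satellite.omega C) ^ 3) : ℝ)) ∧
        g₃ ≠ 0 ∧
        ∃ R : ℝ, 0 < R ∧ ∀ z₀ : ℂ, R < ‖z₀‖ →
          ∀ l : ℂ → ℂ, AnalyticAt ℂ l z₀ → (∀ᶠ z in 𝓝 z₀, Complex.exp (l z) = z⁻¹) →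
            LinODE.IsFundamentalSystem 0 (fun z => -Satellite.r C ξ k z)
              ![fun z => z⁻¹ * f z⁻¹,
                fun z => g₃ * (z⁻¹ * f z⁻¹) * l z + z ^ 2 * V z⁻¹] z₀) ∧
    -- the local monodromy of `W'' = r W` at infinity
    LinODE.HasLocalMonodromyAtInfty 0 (fun z => -Satellite.r C ξ k z)
      !![1, 2 * Real.pi * Complex.I; 0, 1] := by
  obtain ⟨S, hS, hr⟩ := Satellite.exists_r_inv_eq (ξ := ξ) hk₀ hk₁ hC
  -- the parameters are real, so the coefficients of `σ` are named as real numbers and cast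
  generalize ha : 2 / Satellite.omega C = a at hr
  generalize hb : Satellite.qConst C ξ k / Satellite.omega C ^ 2
    + 3 / 2 * (k ^ 2 - Satellite.kPrime k ^ 2) = b at hr
  generalize hc : 2 * (k ^ 2 - Satellite.kPrime k ^ 2) / Satellite.omega C = c at hr
  set σ : ℂ → ℂ := fun ζ => a + b * ζ + c * ζ ^ 2 + ζ ^ 3 * S ζ with hσdef
  have hσ : AnalyticAt ℂ σ 0 := by fun_prop
  obtain ⟨s0, s1, s2⟩ := LinODE.taylorCoeff_cubic hS fun ζ => congrFun hσdef ζ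
  obtain ⟨f, hf, hf0, hode⟩ := LinODE.exists_frobenius_solution hσ
  have hg := LinODE.taylorCoeff_three_one_div_sq hσ hf hf0 hode
  have hh : AnalyticAt ℂ (fun ζ => 1 / f ζ ^ 2) 0 :=
    analyticAt_const.div (hf.pow 2) (by simp [hf0])
  obtain ⟨H, hH, hHe⟩ := LinODE.exists_analyticAt_id_mul_deriv_sub hh
  set g : ℂ := LinODE.taylorCoeff (fun ζ => 1 / f ζ ^ 2) 3 with hgdef
  have hgval : g = (((if C < 1 then Satellite.omega C ^ 2 else -Satellite.omega C ^ 2) - 2 * ξ) /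
      (9 * Satellite.omega C ^ 3) : ℝ) := by
    rw [hg, s0, s1, s2, ← Satellite.logCoeff_eq hk₀ hk₁ hC ha.symm hb.symm hc.symm]
    push_cast
    rfl
  have hg0 : g ≠ 0 := by
    rw [hgval]
    exact_mod_cast Satellite.logCoeff_ne_zero hC hξ
  obtain ⟨R, hR, hdata⟩ := LinODE.exists_isFrobeniusDataAt hσ hf hH hf0 hr hode hHe
  have hopen : IsOpen {z : ℂ | R < ‖z‖} := isOpen_lt continuous_const continuous_norm
  have hnear {z₀ : ℂ} (hz₀ : R < ‖z₀‖) :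
      ∀ᶠ z in 𝓝 z₀, LinODE.IsFrobeniusDataAt (Satellite.r C ξ k) σ f H g z :=
    (hopen.eventually_mem hz₀).mono hdata
  refine ⟨LinODE.setOf_isExponentAtInfty_eq hσ hr,
    ⟨f, fun ζ => f ζ * H ζ, hf, hf0, hf.mul hH, g, rfl, ?_, ?_, hg0, R, hR, ?_⟩,
    R, hR, ?_, ?_⟩
  · intro h
    rw [hgval, if_pos h]
  · intro h
    rw [hgval, if_neg h.not_gt]
  · intro z₀ hz₀ l hl hexp
    exact LinODE.IsFrobeniusDataAt.isFundamentalSystem (hnear hz₀)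
      (LinODE.hasDerivAt_of_exp_eq_inv hl hexp)
  · intro z hz
    refine ⟨analyticAt_const, AnalyticAt.neg ?_⟩
    have hinv : AnalyticAt ℂ (fun z : ℂ => z⁻¹) z := analyticAt_inv (hdata z hz).ne_zero
    have : AnalyticAt ℂ (fun z => z⁻¹ ^ 2 * (2 + z⁻¹ * σ z⁻¹)) z :=
      (hinv.pow 2).mul (analyticAt_const.add
        (hinv.mul ((hdata z hz).analyticAt_σ.comp (f := fun z : ℂ => z⁻¹) hinv)))
    exact this.congr ((hnear hz).mono fun w hw => hw.r_eq.symm)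
  · intro z₀ hz₀
    have hz0 : z₀ ≠ 0 := (hdata z₀ hz₀).ne_zero
    have hc : Complex.exp (Complex.log z₀⁻¹) = z₀⁻¹ := Complex.exp_log (inv_ne_zero hz0)
    refine ⟨_, (LinODE.IsFrobeniusDataAt.isFundamentalSystem (hnear hz₀)
      (LinODE.hasDerivAt_of_exp_eq_inv (LinODE.analyticAt_logInvBranch hc hz0)
        ((continuousAt_id.eventually_ne hz0).mono fun z hz =>
          LinODE.exp_logInvBranch _ hz))).const_mul_left hg0, fun γ hγ hγ1 => ?_⟩
    exact LinODE.hasMonodromyAlong_logInvBranch g (fun t => (hdata _ (hγ t)).analyticAt_first)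
      (fun t => (hdata _ (hγ t)).analyticAt_second) (fun t => (hdata _ (hγ t)).ne_zero) hc hγ1
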